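/- Let $K$ be an algebraically closed field of characteristic zero, and let $(R_K,\le)$ be a linearly ordered $\mathbb{Q}$-vector space, i.e. a $\mathbb{Q}$-vector space with a linear order such that $v_1>v_2$ implies $v_1+v>v_2+v$, and $qv>0$ whenever $q\in\mathbb{Q}$, $q>0$ and $v\in R_K$, $v>0$. Let $K_P[[x]]$ be the generalised Puiseux (Hahn) series field, i.e. the field of all formal series $\sum_{\mu\in R_K} c_\mu x^\mu$ with $c_\mu\in K$ whose set of exponents $\{\mu\in R_K : c_\mu\neq 0\}$ is a well-ordered subset of $R_K$, with coefficientwise addition and the multiplication $\bigl(\sum_\mu a_\mu x^\mu\bigr)\bigl(\sum_\nu b_\nu x^\nu\bigr)=\sum_\lambda\bigl(\sum_{\mu+\nu=\lambda}a_\mu b_\nu\bigr)x^\lambda$. Then $K_P[[x]]$ is algebraically closed. -/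

import Mathlib

/-- The generalised Puiseux field over `K` with exponents in `R`: formal series
`∑ c_μ x^μ` with `c_μ ∈ K`, `μ ∈ R`, whose set of exponents `{μ | c_μ ≠ 0}` is a well-ordered
subset of `R` (for a linear order, partially well-ordered is the same as well-ordered), with
coefficientwise addition and the Cauchy product. This is Mathlib's field of Hahn series. -/
abbrev GenPuiseuxSeries (R K : Type*) [LinearOrder R] [Zero K] : Type _ :=
  HahnSeries R K

open Polynomial

/-- A map on Hahn series supported in a well-ordered set has a fixed point as soon as each
coefficient of its value depends only on the earlier coefficients of the argument. -/
theorem HahnSeries.exists_fixedPoint {Γ V : Type*} [LinearOrder Γ] [Zero V] {S : Set Γ}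
    (hS : S.IsPWO) (F : HahnSeries Γ V → Γ → V)
    (hF : ∀ x y : HahnSeries Γ V, x.support ⊆ S → y.support ⊆ S → ∀ l ∈ S,
      (∀ m < l, x.coeff m = y.coeff m) → F x l = F y l) :
    ∃ x : HahnSeries Γ V, x.support ⊆ S ∧ ∀ l ∈ S, x.coeff l = F x l := by
  classical
  have hsub (f : S → V) : (Function.support fun l => if h : l ∈ S then f ⟨l, h⟩ else 0) ⊆ S := by
    intro l hl
    by_contra h
    simp [h] at hl
  let mk (f : S → V) : HahnSeries Γ V :=
    ⟨fun l => if h : l ∈ S then f ⟨l, h⟩ else 0, hS.mono (hsub f)⟩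
  have hwf : WellFounded fun a b : S => a < b := hS.isWF
  let f : S → V := hwf.fix fun l ih => F (mk fun m => if h : m < l then ih m h else 0) l
  refine ⟨mk f, hsub f, fun l hl => ?_⟩
  have h1 : (mk f).coeff l = f ⟨l, hl⟩ := dif_pos hl
  rw [h1]
  refine (hwf.fix_eq _ _).trans (hF
    (mk fun m => if m < ⟨l, hl⟩ then f m else 0) (mk f)
    (hsub fun m => if m < ⟨l, hl⟩ then f m else 0) (hsub f) l hl fun m hm => ?_)
  by_cases h : m ∈ S
  · simp only [mk, h, dif_pos]
    exact dif_pos (show (⟨m, h⟩ : S) < ⟨l, hl⟩ from hm)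
  · simp [mk, h]

theorem HahnSeries.coeff_mul_eq_zero_of_support {Γ A : Type*} [AddCommGroup Γ] [LinearOrder Γ]
    [IsOrderedAddMonoid Γ] [Semiring A] {x y : HahnSeries Γ A} {l : Γ}
    (hx : ∀ m ∈ x.support, 0 < m) (hy : ∀ m ∈ y.support, l ≤ m) : (x * y).coeff l = 0 := by
  by_contra h
  obtain ⟨a, ha, b, hb, hab⟩ := Set.mem_add.1 (HahnSeries.support_mul_subset h)
  exact absurd hab (lt_add_of_pos_of_le (hx a ha) (hy b hb)).ne'

theorem HahnSeries.coeff_mul_congr_of_lt {Γ A : Type*} [AddCommGroup Γ] [LinearOrder Γ]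
    [IsOrderedAddMonoid Γ] [CommRing A] {x y x' y' : HahnSeries Γ A} {l : Γ}
    (hx : ∀ m ∈ x.support, 0 < m) (hy' : ∀ m ∈ y'.support, 0 < m)
    (hxx' : ∀ m < l, x.coeff m = x'.coeff m) (hyy' : ∀ m < l, y.coeff m = y'.coeff m) :
    (x * y).coeff l = (x' * y').coeff l := by
  have key {z z' : HahnSeries Γ A} (h : ∀ m < l, z.coeff m = z'.coeff m) :
      ∀ m ∈ (z - z').support, l ≤ m := by
    intro m hm
    by_contra hlt
    exact hm (by simp [h m (not_le.1 hlt)])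
  have h1 := coeff_mul_eq_zero_of_support hx (key hyy')
  have h2 := coeff_mul_eq_zero_of_support hy' (key hxx')
  have h3 : x * y = x' * y' + (x * (y - y') + y' * (x - x')) := by ring
  rw [h3, coeff_add, coeff_add, h1, h2, add_zero, add_zero]

theorem Polynomial.exists_bezout_degree_lt {K : Type*} [Field K] {g h : K[X]} (hg : g.Monic)
    (hgh : IsCoprime g h) {c : K[X]} (hc : c.degree < (g * h).degree) :
    ∃ a b : K[X], a.degree < g.degree ∧ b.degree < h.degree ∧ g * b + h * a = c := by
  obtain ⟨u, v, huv⟩ := hgh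
  set a := (v * c) %ₘ g with ha
  have hdeg : a.degree < g.degree := degree_modByMonic_lt _ hg
  have hdvd : c - h * a = g * (u * c + h * ((v * c) /ₘ g)) := by
    have h1 : a = v * c - g * ((v * c) /ₘ g) :=
      eq_sub_of_add_eq (modByMonic_add_div (v * c) g)
    rw [h1]
    linear_combination (-c) * huv
  refine ⟨a, _, hdeg, ?_, by rw [← hdvd]; ring⟩
  have hh : h ≠ 0 := by
    rintro rfl
    simp at hc
  have h2 : (c - h * a).degree < (g * h).degree := by
    refine (degree_sub_le _ _).trans_lt (max_lt hc ?_)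
    rw [mul_comm, degree_mul, degree_mul]
    exact WithBot.add_lt_add_right (degree_ne_bot.2 hh) hdeg
  rw [hdvd, degree_mul, degree_mul] at h2
  exact lt_of_add_lt_add_left h2

theorem HahnSeries.degree_coeff_mul_lt {Γ K : Type*} [AddCommGroup Γ] [LinearOrder Γ]
    [IsOrderedAddMonoid Γ] [Field K] {x y : HahnSeries Γ K[X]} {g h : K[X]} (hg : g ≠ 0)
    (hh : h ≠ 0)
    (hx : ∀ l, (x.coeff l).degree < g.degree) (hy : ∀ l, (y.coeff l).degree < h.degree) (l : Γ) :
    ((x * y).coeff l).degree < (g * h).degree := by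
  rw [HahnSeries.coeff_mul]
  refine (degree_sum_le _ _).trans_lt ((Finset.sup_lt_iff ?_).2 fun i _ => ?_)
  · exact bot_lt_iff_ne_bot.2 (degree_ne_bot.2 (mul_ne_zero hg hh))
  · rw [degree_mul, degree_mul]
    exact (add_le_add_left (hx _).le _).trans_lt
      (WithBot.add_lt_add_left (degree_ne_bot.2 hg) (hy _))

/-- Hensel's lemma: a coprime factorisation of the constant coefficient lifts. -/
theorem HahnSeries.exists_lift_factorization {Γ K : Type*} [AddCommGroup Γ] [LinearOrder Γ]
    [IsOrderedAddMonoid Γ] [Field K] {g h : K[X]} (hg : g.Monic) (hh : h.Monic)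
    (hgh : IsCoprime g h) {Q : HahnSeries Γ K[X]} (hQ : ∀ l ∈ Q.support, 0 < l)
    (hQd : ∀ l, (Q.coeff l).degree < (g * h).degree) :
    ∃ A B : HahnSeries Γ K[X], (∀ l, (A.coeff l).degree < g.degree) ∧
      (∀ l, (B.coeff l).degree < h.degree) ∧
      (single 0 g + A) * (single 0 h + B) = single 0 (g * h) + Q := by
  classical
  have hL (c : K[X]) : ∃ p : K[X] × K[X], p.1.degree < g.degree ∧ p.2.degree < h.degree ∧
      (c.degree < (g * h).degree → g * p.2 + h * p.1 = c) := by
    by_cases hc : c.degree < (g * h).degree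
    · obtain ⟨a, b, ha, hb, hab⟩ := exists_bezout_degree_lt hg hgh hc
      exact ⟨(a, b), ha, hb, fun _ => hab⟩
    · exact ⟨0, by simpa [bot_lt_iff_ne_bot] using hg.ne_zero,
        by simpa [bot_lt_iff_ne_bot] using hh.ne_zero, fun h => absurd h hc⟩
  choose L hL1 hL2 hL3 using hL
  let T : Set Γ := AddSubmonoid.closure Q.support
  let S : Set Γ := T ∩ {l | 0 < l}
  have hS : S.IsPWO :=
    (Q.isPWO_support.addSubmonoid_closure fun l hl => (hQ l hl).le).mono Set.inter_subset_left
  have hQS : Q.support ⊆ S := fun l hl => ⟨AddSubmonoid.subset_closure hl, hQ l hl⟩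
  let fst (x : HahnSeries Γ (K[X] × K[X])) : HahnSeries Γ K[X] := x.map (AddMonoidHom.fst K[X] K[X])
  let snd (x : HahnSeries Γ (K[X] × K[X])) : HahnSeries Γ K[X] := x.map (AddMonoidHom.snd K[X] K[X])
  have hfst (x) (l) : (fst x).coeff l = (x.coeff l).1 := rfl
  have hsnd (x) (l) : (snd x).coeff l = (x.coeff l).2 := rfl
  have hfstS (x : HahnSeries Γ (K[X] × K[X])) (hx : x.support ⊆ S) : (fst x).support ⊆ S := by
    refine fun l hl => hx fun h0 => hl ?_
    rw [hfst, h0, Prod.fst_zero]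
  have hsndS (x : HahnSeries Γ (K[X] × K[X])) (hx : x.support ⊆ S) : (snd x).support ⊆ S := by
    refine fun l hl => hx fun h0 => hl ?_
    rw [hsnd, h0, Prod.snd_zero]
  obtain ⟨x, hxS, hx⟩ := exists_fixedPoint hS (fun x l => L ((Q - fst x * snd x).coeff l)) (by
    intro x y hx hy l hl hxy
    simp only [coeff_sub]
    rw [coeff_mul_congr_of_lt (fun m hm => (hfstS x hx hm).2) (fun m hm => (hsndS y hy hm).2)]
    · intro m hm
      rw [hfst, hfst, hxy m hm]
    · intro m hm
      rw [hsnd, hsnd, hxy m hm])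
  have hx0 (l) (hl : l ∉ S) : x.coeff l = 0 := not_not.1 fun h => hl (hxS h)
  have hA (l) : ((fst x).coeff l).degree < g.degree := by
    by_cases hl : l ∈ S
    · rw [hfst, hx l hl]
      exact hL1 _
    · rw [hfst, hx0 l hl]
      simpa [bot_lt_iff_ne_bot] using hg.ne_zero
  have hB (l) : ((snd x).coeff l).degree < h.degree := by
    by_cases hl : l ∈ S
    · rw [hsnd, hx l hl]
      exact hL2 _
    · rw [hsnd, hx0 l hl]
      simpa [bot_lt_iff_ne_bot] using hh.ne_zero
  have hW (l) : ((Q - fst x * snd x).coeff l).degree < (g * h).degree := by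
    rw [coeff_sub]
    exact (degree_sub_le _ _).trans_lt
      (max_lt (hQd l) (degree_coeff_mul_lt hg.ne_zero hh.ne_zero hA hB l))
  refine ⟨fst x, snd x, hA, hB, ?_⟩
  have key : single 0 g * snd x + single 0 h * fst x = Q - fst x * snd x := by
    ext1
    funext l
    rw [coeff_add, coeff_single_zero_mul, coeff_single_zero_mul]
    by_cases hl : l ∈ S
    · rw [← hL3 _ (hW l), ← hx l hl, hfst, hsnd]
    · rw [hfst, hsnd, hx0 l hl, Prod.fst_zero, Prod.snd_zero, mul_zero, mul_zero, add_zero]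
      by_contra hne
      have hne' : Q.coeff l - (fst x * snd x).coeff l ≠ 0 := fun h => hne (by rw [coeff_sub, h])
      have hQl : Q.coeff l = 0 := not_not.1 fun h => hl (hQS h)
      rw [hQl, zero_sub, neg_ne_zero] at hne'
      obtain ⟨a, ha, b, hb, rfl⟩ := Set.mem_add.1 (support_mul_subset hne')
      have ha' := hfstS x hxS ha
      have hb' := hsndS x hxS hb
      exact hl ⟨AddSubmonoid.add_mem _ ha'.1 hb'.1, add_pos ha'.2 hb'.2⟩
  have h0 : (single 0 (g * h) : HahnSeries Γ K[X]) = single 0 g * single 0 h := by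
    rw [single_mul_single, add_zero]
  rw [h0]
  linear_combination key

/-- A polynomial over Hahn series, viewed as a Hahn series of polynomials. -/
noncomputable def Polynomial.toHahnSeries (Γ K : Type*) [AddCommGroup Γ] [LinearOrder Γ]
    [IsOrderedAddMonoid Γ] [Field K] : (HahnSeries Γ K)[X] →+* HahnSeries Γ K[X] :=
  eval₂RingHom
    { toFun := fun x => x.map (C : K →+* K[X])
      map_one' := HahnSeries.map_one (C : K →+* K[X]).toMonoidWithZeroHom
      map_mul' := fun _ _ => HahnSeries.map_mul (C : K →+* K[X]).toNonUnitalRingHom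
      map_zero' := HahnSeries.map_zero ((C : K →+* K[X]) : ZeroHom K K[X])
      map_add' := fun _ _ => HahnSeries.map_add (C : K →+* K[X]).toAddMonoidHom }
    (HahnSeries.single 0 X)

section

variable {Γ K : Type*} [AddCommGroup Γ] [LinearOrder Γ] [IsOrderedAddMonoid Γ] [Field K]

theorem Polynomial.coeff_coeff_toHahnSeries (p : (HahnSeries Γ K)[X]) (l : Γ) (i : ℕ) :
    ((toHahnSeries Γ K p).coeff l).coeff i = (p.coeff i).coeff l := by
  induction p using Polynomial.induction_on' with
  | add p q hp hq => rw [map_add, HahnSeries.coeff_add, coeff_add, hp, hq, coeff_add,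
      HahnSeries.coeff_add]
  | monomial n a =>
    have h : toHahnSeries Γ K (monomial n a) =
        a.map (C : K →+* K[X]) * HahnSeries.single 0 (X ^ n) := by
      have := HahnSeries.single_pow (0 : Γ) n (X : K[X])
      rw [nsmul_zero] at this
      rw [← this]
      exact eval₂_monomial _ _
    rw [h, HahnSeries.coeff_mul_single_zero, coeff_monomial]
    change (C (a.coeff l) * X ^ n).coeff i = _
    rw [coeff_C_mul_X_pow]
    simp only [eq_comm (a := i)]
    split_ifs <;> simp

theorem Polynomial.toHahnSeries_injective : Function.Injective (toHahnSeries Γ K) := by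
  intro p q h
  ext i l
  rw [← coeff_coeff_toHahnSeries, h, coeff_coeff_toHahnSeries]

theorem Polynomial.exists_toHahnSeries_eq {A : HahnSeries Γ K[X]} {n : ℕ}
    (hA : ∀ l, (A.coeff l).degree < n) :
    ∃ p : (HahnSeries Γ K)[X], p.degree < n ∧ toHahnSeries Γ K p = A := by
  let f (i : ℕ) : HahnSeries Γ K := A.map (lcoeff K i)
  refine ⟨∑ i ∈ Finset.range n, monomial i (f i), ?_, ?_⟩
  · refine (degree_sum_le _ _).trans_lt ((Finset.sup_lt_iff (WithBot.bot_lt_coe n)).2 ?_)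
    intro i hi
    exact (degree_monomial_le _ _).trans_lt (Nat.cast_lt.2 (Finset.mem_range.1 hi))
  · ext l i
    rw [coeff_coeff_toHahnSeries, finsetSum_coeff]
    simp only [coeff_monomial]
    rw [Finset.sum_ite_eq' (Finset.range n) i f]
    split_ifs with h
    · rfl
    · rw [coeff_eq_zero_of_degree_lt ((hA l).trans_le _)]
      · rfl
      · exact_mod_cast not_lt.1 fun h' => h (Finset.mem_range.2 h')

/-- Hensel's lemma over the valuation ring of a field of Hahn series. -/
theorem Polynomial.Monic.exists_mul_of_toHahnSeries {p : (HahnSeries Γ K)[X]} (hp : p.Monic)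
    (hpos : ∀ i, ∀ l < 0, (p.coeff i).coeff l = 0) {g h : K[X]} (hg : g.Monic) (hh : h.Monic)
    (hgh : IsCoprime g h) (hp0 : (toHahnSeries Γ K p).coeff 0 = g * h) :
    ∃ G H : (HahnSeries Γ K)[X], G.Monic ∧ H.Monic ∧ G.natDegree = g.natDegree ∧
      H.natDegree = h.natDegree ∧ p = G * H := by
  have hlift {g : K[X]} (hg : g.Monic) {A : HahnSeries Γ K[X]}
      (hA : ∀ l, (A.coeff l).degree < g.degree) : ∃ G : (HahnSeries Γ K)[X], G.Monic ∧
        G.natDegree = g.natDegree ∧ toHahnSeries Γ K G = HahnSeries.single 0 g + A := by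
    have hA' (l) : ((HahnSeries.single 0 (g - X ^ g.natDegree) + A).coeff l).degree
        < ((g.natDegree : ℕ) : WithBot ℕ) := by
      rw [HahnSeries.coeff_add]
      refine (degree_add_le _ _).trans_lt (max_lt ?_ ?_)
      · rw [HahnSeries.coeff_single]
        split_ifs
        · rw [← degree_eq_natDegree hg.ne_zero]
          exact degree_sub_lt_left (by rw [degree_X_pow, degree_eq_natDegree hg.ne_zero]) hg.ne_zero
            (by rw [hg.leadingCoeff, leadingCoeff_X_pow])
        · simp
      · rw [← degree_eq_natDegree hg.ne_zero]
        exact hA l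
    obtain ⟨q, hq, hqA⟩ := exists_toHahnSeries_eq hA'
    refine ⟨X ^ g.natDegree + q, monic_X_pow_add hq, ?_, ?_⟩
    · exact natDegree_eq_of_degree_eq_some
        (by rw [degree_add_eq_left_of_degree_lt] <;> rw [degree_X_pow]; exact hq)
    · have hX : toHahnSeries Γ K (X ^ g.natDegree) = HahnSeries.single 0 (X ^ g.natDegree) := by
        have := HahnSeries.single_pow (0 : Γ) g.natDegree (X : K[X])
        rw [nsmul_zero] at this
        rw [map_pow, ← this]
        congr 1
        exact eval₂_X _ _
      rw [map_add, hX, hqA, ← add_assoc, ← HahnSeries.single_add, add_sub_cancel]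
  have hgd : (g * h).Monic := hg.mul hh
  have hdeg : p.natDegree = (g * h).natDegree := by
    apply le_antisymm <;> apply le_natDegree_of_ne_zero
    · rw [← hp0, coeff_coeff_toHahnSeries, hp.coeff_natDegree]
      simp
    · intro h0
      have h1 := hgd.coeff_natDegree
      rw [← hp0, coeff_coeff_toHahnSeries, hp0, h0, HahnSeries.coeff_zero] at h1
      exact zero_ne_one h1
  obtain ⟨A, B, hA, hB, hAB⟩ := HahnSeries.exists_lift_factorization hg hh hgh
    (Q := toHahnSeries Γ K p - HahnSeries.single 0 (g * h)) (by
      intro l hl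
      by_contra hlt
      refine hl ?_
      rw [HahnSeries.coeff_sub]
      rcases (not_lt.1 hlt).lt_or_eq with h | rfl
      · rw [HahnSeries.coeff_single_of_ne h.ne, sub_zero]
        ext i
        rw [coeff_coeff_toHahnSeries, hpos i l h, coeff_zero]
      · rw [hp0, HahnSeries.coeff_single_same, sub_self]) (by
      intro l
      rw [degree_eq_natDegree hgd.ne_zero, degree_lt_iff_coeff_zero]
      intro m hm
      rw [HahnSeries.coeff_sub, coeff_sub, coeff_coeff_toHahnSeries, HahnSeries.coeff_single]
      rcases hm.lt_or_eq with hm | rfl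
      · rw [coeff_eq_zero_of_natDegree_lt (hdeg.trans_lt hm)]
        split_ifs
        · rw [coeff_eq_zero_of_natDegree_lt hm, HahnSeries.coeff_zero, sub_zero]
        · rw [HahnSeries.coeff_zero, coeff_zero, sub_zero]
      · rw [← hdeg, hp.coeff_natDegree, HahnSeries.coeff_one]
        split_ifs
        · rw [hdeg, hgd.coeff_natDegree, sub_self]
        · rw [coeff_zero, sub_zero])
  obtain ⟨G, hG, hGd, hGA⟩ := hlift hg hA
  obtain ⟨H, hH, hHd, hHB⟩ := hlift hh hB
  refine ⟨G, H, hG, hH, hGd, hHd, toHahnSeries_injective ?_⟩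
  rw [map_mul, hGA, hHB, hAB, add_sub_cancel]

end

theorem Polynomial.Monic.exists_coprime_factors_of_isAlgClosed {K : Type*} [Field K] [CharZero K]
    [IsAlgClosed K] {r : K[X]} (hr : r.Monic) (hpos : 0 < r.natDegree)
    (h1 : r.coeff (r.natDegree - 1) = 0) (hne : r ≠ X ^ r.natDegree) :
    ∃ g h : K[X], g.Monic ∧ h.Monic ∧ IsCoprime g h ∧ r = g * h ∧ 0 < g.natDegree ∧
      g.natDegree < r.natDegree := by
  obtain ⟨a, ha⟩ := IsAlgClosed.exists_root r (natDegree_pos_iff_degree_pos.1 hpos).ne'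
  obtain ⟨q, hq, hdvd⟩ := exists_eq_pow_rootMultiplicity_mul_and_not_dvd r hr.ne_zero a
  set m := r.rootMultiplicity a with hm
  have hm0 : 0 < m := (rootMultiplicity_pos hr.ne_zero).2 ha
  have hg : ((X - C a) ^ m).Monic := (monic_X_sub_C a).pow m
  have hqm : q.Monic := hg.of_mul_monic_left (hq ▸ hr)
  have hgd : ((X - C a) ^ m).natDegree = m := by
    rw [(monic_X_sub_C a).natDegree_pow, natDegree_X_sub_C, mul_one]
  have hrd : r.natDegree = m + q.natDegree := by
    conv_lhs => rw [hq]
    rw [hg.natDegree_mul hqm, hgd]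
  refine ⟨(X - C a) ^ m, q, hg, hqm, ?_, hq, by rwa [hgd], ?_⟩
  · exact (((irreducible_X_sub_C a).coprime_iff_not_dvd).2 hdvd).pow_left
  · rw [hgd, hrd]
    refine Nat.lt_add_of_pos_right (Nat.pos_of_ne_zero fun hq0 => hne ?_)
    have hq1 : q = 1 := hqm.natDegree_eq_zero.1 hq0
    rw [hq1, mul_one] at hq
    have h2 : r.nextCoeff = 0 := by rw [nextCoeff_of_natDegree_pos hpos, h1]
    rw [hq, (monic_X_sub_C a).nextCoeff_pow, nextCoeff_X_sub_C, smul_neg, neg_eq_zero,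
      smul_eq_zero] at h2
    have ha0 := h2.resolve_left hm0.ne'
    rw [hrd, hq0, add_zero]
    conv_lhs => rw [hq, ha0, C_0, sub_zero]

theorem Polynomial.exists_taylor_coeff_eq_zero {F : Type*} [Field F] [CharZero F] {p : F[X]}
    (hpos : 0 < p.natDegree) : ∃ c, (taylor c p).coeff (p.natDegree - 1) = 0 := by
  set n := p.natDegree with hn
  have hle : (hasseDeriv (n - 1) p).natDegree ≤ 1 :=
    (natDegree_hasseDeriv_le p (n - 1)).trans (by omega)
  have h1 : (hasseDeriv (n - 1) p).coeff 1 ≠ 0 := by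
    rw [hasseDeriv_coeff, show 1 + (n - 1) = n by omega]
    refine mul_ne_zero (Nat.cast_ne_zero.2 (Nat.choose_pos (by omega)).ne') ?_
    exact leadingCoeff_ne_zero.2 (ne_zero_of_natDegree_gt hpos)
  refine ⟨-(hasseDeriv (n - 1) p).coeff 0 / (hasseDeriv (n - 1) p).coeff 1, ?_⟩
  rw [taylor_coeff, eval_eq_sum_range' (Nat.lt_succ_of_le hle), Finset.sum_range_succ,
    Finset.sum_range_one]
  field_simp
  ring

section

variable {Γ K : Type*} [AddCommGroup Γ] [LinearOrder Γ] [IsOrderedAddMonoid Γ] [Field K]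

theorem HahnSeries.exists_slope [Module ℚ Γ] {q : (HahnSeries Γ K)[X]} {n : ℕ}
    (hq : ∃ i < n, q.coeff i ≠ 0) :
    ∃ γ : Γ, (∀ i < n, q.coeff i ≠ 0 → (n - i) • γ ≤ (q.coeff i).order) ∧
      ∃ i < n, q.coeff i ≠ 0 ∧ (n - i) • γ = (q.coeff i).order := by
  classical
  let s := (Finset.range n).filter fun i => q.coeff i ≠ 0
  let f (i : ℕ) : Γ := ((n - i : ℕ) : ℚ)⁻¹ • (q.coeff i).order
  have hf (i) (hi : i < n) : (n - i) • f i = (q.coeff i).order := by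
    rw [← Nat.cast_smul_eq_nsmul ℚ]
    exact smul_inv_smul₀ (Nat.cast_ne_zero.2 (Nat.sub_pos_of_lt hi).ne') _
  obtain ⟨i₀, hi₀, hi₀'⟩ := hq
  obtain ⟨j, hj, hmin⟩ := s.exists_min_image f
    ⟨i₀, Finset.mem_filter.2 ⟨Finset.mem_range.2 hi₀, hi₀'⟩⟩
  obtain ⟨hjn, hj0⟩ := Finset.mem_filter.1 hj
  refine ⟨f j, fun i hi hi0 => ?_, j, Finset.mem_range.1 hjn, hj0, hf j (Finset.mem_range.1 hjn)⟩
  rw [← hf i hi]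
  exact nsmul_le_nsmul_right (hmin i (Finset.mem_filter.2 ⟨Finset.mem_range.2 hi, hi0⟩)) _

/-- Rescaling the variable makes a monic polynomial over Hahn series integral with nontrivial
residue. -/
theorem Polynomial.Monic.exists_scaleRoots_integral [Module ℚ Γ] {q : (HahnSeries Γ K)[X]}
    (hq : q.Monic) (hne : q ≠ X ^ q.natDegree) :
    ∃ s : HahnSeries Γ K, s ≠ 0 ∧
      (∀ i, ∀ l < 0, ((q.scaleRoots s).coeff i).coeff l = 0) ∧
      ∃ i < q.natDegree, ((q.scaleRoots s).coeff i).coeff 0 ≠ 0 := by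
  have hex : ∃ i < q.natDegree, q.coeff i ≠ 0 := by
    by_contra! h
    refine hne (ext fun i => ?_)
    rw [coeff_X_pow]
    rcases lt_trichotomy i q.natDegree with hi | hi | hi
    · rw [h i hi, if_neg hi.ne]
    · rw [if_pos hi, hi, hq.coeff_natDegree]
    · rw [coeff_eq_zero_of_natDegree_lt hi, if_neg hi.ne']
  obtain ⟨γ, hγ, j, hj, hj0, hjγ⟩ := HahnSeries.exists_slope hex
  have hc (i : ℕ) (l : Γ) : ((q.scaleRoots (HahnSeries.single (-γ) 1)).coeff i).coeff l =
      (q.coeff i).coeff (l + (q.natDegree - i) • γ) := by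
    rw [coeff_scaleRoots, HahnSeries.single_pow, HahnSeries.coeff_mul_single, one_pow, mul_one,
      smul_neg, sub_neg_eq_add]
  refine ⟨HahnSeries.single (-γ) 1, HahnSeries.single_ne_zero one_ne_zero, fun i l hl => ?_,
    j, hj, ?_⟩
  · rw [hc]
    by_cases h0 : q.coeff i = 0
    · rw [h0, HahnSeries.coeff_zero]
    · rcases lt_trichotomy i q.natDegree with hi | rfl | hi
      · exact HahnSeries.coeff_eq_zero_of_lt_order
          ((add_lt_of_neg_left _ hl).trans_le (hγ i hi h0))
      · rw [hq.coeff_natDegree, Nat.sub_self, zero_smul, add_zero, HahnSeries.coeff_one,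
          if_neg hl.ne]
      · exact absurd (coeff_eq_zero_of_natDegree_lt hi) h0
  · rw [hc, zero_add, hjγ]
    exact fun h => hj0 (HahnSeries.coeff_order_eq_zero.1 h)

theorem HahnSeries.exists_root_of_monic [Module ℚ Γ] [CharZero K] [IsAlgClosed K] (n : ℕ) :
    ∀ p : (HahnSeries Γ K)[X], p.Monic → 0 < p.natDegree → p.natDegree = n →
      ∃ x, p.eval x = 0 := by
  induction n using Nat.strong_induction_on with
  | _ n ih =>
  intro p hp hpos hpn
  have : CharZero (HahnSeries Γ K) :=
    charZero_of_injective_ringHom (HahnSeries.C_injective (Γ := Γ) (R := K))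
  obtain ⟨c, hc⟩ := exists_taylor_coeff_eq_zero hpos
  set q := taylor c p with hqdef
  have hqd : q.natDegree = n := (natDegree_taylor p c).trans hpn
  have hq : q.Monic := (leadingCoeff_taylor ..).trans hp
  suffices h : ∃ x, q.eval x = 0 by
    obtain ⟨x, hx⟩ := h
    exact ⟨x + c, by rw [← taylor_eval, hx]⟩
  by_cases hX : q = X ^ q.natDegree
  · refine ⟨0, ?_⟩
    rw [hX, eval_pow, eval_X, zero_pow (by omega)]
  obtain ⟨s, hs, hint, i, hi, hi0⟩ := hq.exists_scaleRoots_integral hX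
  set r := q.scaleRoots s with hrdef
  have hrd : r.natDegree = n := (natDegree_scaleRoots q s).trans hqd
  have hr : r.Monic := (monic_scaleRoots_iff s).2 hq
  suffices h : ∃ x, r.eval x = 0 by
    obtain ⟨x, hx⟩ := h
    refine ⟨s⁻¹ * x, ?_⟩
    have h1 := scaleRoots_eval_mul r x s⁻¹
    rwa [hrdef, ← scaleRoots_mul, mul_inv_cancel₀ hs, scaleRoots_one, ← hrdef, hx,
      mul_zero] at h1
  set r₀ := (toHahnSeries Γ K r).coeff 0 with hr₀
  have hr₀c (k : ℕ) : r₀.coeff k = (r.coeff k).coeff 0 := coeff_coeff_toHahnSeries ..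
  have hr₀n : r₀.coeff n = 1 := by
    rw [hr₀c, ← hrd, hr.coeff_natDegree, HahnSeries.coeff_one, if_pos rfl]
  have hr₀le : r₀.natDegree ≤ n := natDegree_le_iff_coeff_eq_zero.2 fun k hk => by
    rw [hr₀c, coeff_eq_zero_of_natDegree_lt (hrd.trans_lt hk), HahnSeries.coeff_zero]
  have hr₀d : r₀.natDegree = n :=
    natDegree_eq_of_le_of_coeff_ne_zero hr₀le (hr₀n ▸ one_ne_zero)
  have hr₀m : r₀.Monic := monic_of_natDegree_le_of_coeff_eq_one n hr₀le hr₀n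
  obtain ⟨g, h, hg, hh, hgh, hfac, hg0, hgn⟩ := hr₀m.exists_coprime_factors_of_isAlgClosed
    (by omega) (by
      rw [hr₀d, hr₀c, hrdef, coeff_scaleRoots, ← hpn, hc, zero_mul, HahnSeries.coeff_zero])
    (by
      intro hX'
      rw [← hr₀c, hX', hr₀d, coeff_X_pow, if_neg (by omega)] at hi0
      exact hi0 rfl)
  obtain ⟨G, H, hG, -, hGd, -, hGH⟩ := hr.exists_mul_of_toHahnSeries hint hg hh hgh hfac
  obtain ⟨x, hx⟩ := ih G.natDegree (by omega) G hG (by omega) rfl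
  exact ⟨x, by rw [hGH, eval_mul, hx, zero_mul]⟩

end

theorem mainTheorem1 {K : Type*} [Field K] [CharZero K] [IsAlgClosed K]
    {R : Type*} [AddCommGroup R] [Module ℚ R] [LinearOrder R] [IsOrderedAddMonoid R]
    [PosSMulStrictMono ℚ R] :
    IsAlgClosed (GenPuiseuxSeries R K) :=
  IsAlgClosed.of_exists_root _ fun p hp hirr =>
    HahnSeries.exists_root_of_monic _ p hp hirr.natDegree_pos rfl
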